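/- For graphs $G$ and $H$, let the Ramsey number $R(G,H)$ be the least natural number $N$ such that for every graph $F$ of order $N$, either $F$ contains $G$ as a subgraph or the complement $\overline{F}$ contains $H$ as a subgraph. Let $P_n$ be the path on $n$ vertices, and for $s,m\ge 2$ let the generalized Jahangir graph $J_{s,m}$ be the graph on $sm+1$ vertices consisting of a cycle $C_{sm}$ and one additional vertex adjacent to exactly $m$ vertices of $C_{sm}$, consecutive ones of which are at distance $s$ along $C_{sm}$. Let $s\ge 3$ be odd. Then $$R(P_n,J_{s,m})=\begin{cases}2n-1 & \text{if } m\ge 2 \text{ is even and } n\ge \frac{sm}{2}(sm-2),\\[2pt] 2n & \text{if } m\ge 3 \text{ is odd and } n\ge \frac{sm-1}{2}(sm-1).\end{cases}$$ -/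

import Mathlib

/-- `N` has the Ramsey property for `(G, H)`: every graph `F` of order `N` contains `G`, or its
complement contains `H` (as a not necessarily induced subgraph). -/
def RamseyProperty {α β : Type*} (G : SimpleGraph α) (H : SimpleGraph β) (N : ℕ) : Prop :=
  ∀ F : SimpleGraph (Fin N), G.IsContained F ∨ H.IsContained Fᶜ

/-- `R(G, H) = r`: `r` is the least natural number with the Ramsey property for `(G, H)`. -/
def IsRamseyNumber {α β : Type*} (G : SimpleGraph α) (H : SimpleGraph β) (r : ℕ) : Prop :=
  IsLeast {N : ℕ | RamseyProperty G H N} r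

/-- The generalized Jahangir graph `J_{s,m}`: the cycle on the `s * m` vertices `some i`, together
with one additional vertex `none`, adjacent to the `m` cycle vertices
`some 0, some s, some (2 * s), …, some ((m - 1) * s)`. -/
def jahangirGraph (s m : ℕ) : SimpleGraph (Option (Fin (s * m))) where
  Adj
    | none, none => False
    | none, some i => s ∣ i.val
    | some i, none => s ∣ i.val
    | some i, some j => (SimpleGraph.cycleGraph (s * m)).Adj i j
  symm := ⟨by
    rintro (_ | i) (_ | j) h
    · exact h
    · exact h
    · exact h
    · exact SimpleGraph.Adj.symm h⟩
  loopless := ⟨by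
    rintro (_ | i) h
    · exact h
    · exact SimpleGraph.irrefl _ h⟩

/-! Upper bounds. If `F` has no path on `n` vertices, the stack of a depth-first search stays
shorter than `n`. Stopping the search at the right moment gives two large vertex sets with no edge
of `F` between them. Enlarge them to a maximal such pair `A`, `B`, so that any other vertex has
neighbours in both. The complement joins `A` completely to `B`, so an even cycle embeds there by
alternating sides, and a vertex with `m` complement-neighbours on each side can serve as hub. An odd
cycle needs one more such vertex to repair parity. If no Jahangir graph appears, each side is almost
complete in `F`, up to one exceptional vertex in the odd case. Almost complete sides have
Hamiltonian paths with prescribed start (`SimpleGraph.exists_hamiltonian_chain`). Either an outside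
vertex links two of them into a path on `n` vertices, or the sides cover the graph and one of them
already has `n` vertices.

Lower bounds. Take disjoint cliques on at most `n - 1` vertices. A copy of the Jahangir graph in the
complement is properly coloured by the cliques. A hub, two consecutive spokes and the arc between
them form a cycle of odd length `s + 2`, so two colours fail. For odd `m`, no single vertex meets
all odd cycles, so a third class of size one does not help. -/

/-! ### Paths as lists, and depth-first search -/

theorem SimpleGraph.pathGraph_isContained_of_isChain {V : Type*} {F : SimpleGraph V} {l : List V}
    {n : ℕ} (hc : l.IsChain F.Adj) (hl : l.Nodup) (hn : n ≤ l.length) :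
    (SimpleGraph.pathGraph n).IsContained F := by
  rw [List.isChain_iff_getElem] at hc
  refine ⟨⟨⟨fun i => l[i.val], ?_⟩, ?_⟩⟩
  · intro i j hij
    rw [SimpleGraph.pathGraph_adj] at hij
    rcases hij with h | h
    · have := hc i.val (by omega)
      simpa [h] using this
    · have := hc j.val (by omega)
      simpa [h] using this.symm
  · intro i j hij
    have := (hl.getElem_inj_iff).1 hij
    exact Fin.ext this

/-- A depth-first search, stopped when exactly `t` vertices have been completed: `T` is the set of
completed vertices, `U` the set of unvisited ones, and `l` is the current stack. -/
theorem SimpleGraph.exists_depthFirstSearch {V : Type*} [Fintype V] [DecidableEq V]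
    (F : SimpleGraph V) (t : ℕ) (ht : t ≤ Fintype.card V) :
    ∃ (T U : Finset V) (l : List V), l.IsChain F.Adj ∧ l.Nodup ∧ Disjoint T U ∧
      (∀ v ∈ l, v ∉ T ∧ v ∉ U) ∧ (∀ a ∈ T, ∀ b ∈ U, ¬ F.Adj a b) ∧ T.card = t ∧
      T.card + U.card + l.length = Fintype.card V := by
  induction t with
  | zero =>
    exact ⟨∅, Finset.univ, [], by simp [Finset.card_univ]⟩
  | succ t ih =>
    obtain ⟨T, U, l, h⟩ := ih (by omega)
    -- With `t` completed vertices, keep pushing unvisited vertices, each push shrinking `U`, until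
    -- the top of the stack can be completed.
    induction hu : U.card generalizing U l with
    | zero =>
      obtain ⟨hc, hn, hd, hl, he, hT, hN⟩ := h
      obtain rfl := Finset.card_eq_zero.1 hu
      cases l with
      | nil => simp at hN; omega
      | cons p l =>
        refine ⟨insert p T, ∅, l, hc.tail, hn.of_cons, by simp, ?_, by simp, ?_, ?_⟩
        · intro v hv
          have := hl v (by simp [hv])
          have h2 : v ≠ p := by rintro rfl; simp at hn; exact hn.1 hv
          simp [this.1, h2]
        · rw [Finset.card_insert_of_notMem (hl p (by simp)).1, hT]
        · rw [Finset.card_insert_of_notMem (hl p (by simp)).1]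
          simp at hN ⊢; omega
    | succ u ihu =>
      obtain ⟨hc, hn, hd, hl, he, hT, hN⟩ := h
      -- On an empty stack the condition is vacuous, so any unvisited vertex may be pushed.
      by_cases hx : ∃ w ∈ U, ∀ p ∈ l.head?, F.Adj w p
      · obtain ⟨w, hw, hp⟩ := hx
        refine ihu (U.erase w) (w :: l) ⟨?_, ?_, ?_, ?_, ?_, hT, ?_⟩ ?_
        · exact List.isChain_cons.2 ⟨hp, hc⟩
        · exact List.nodup_cons.2 ⟨fun h => (hl w h).2 hw, hn⟩
        · exact hd.mono_right (Finset.erase_subset _ _)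
        · intro v hv
          rcases List.mem_cons.1 hv with rfl | hv
          · exact ⟨fun h => Finset.disjoint_left.1 hd h hw, by simp⟩
          · exact ⟨(hl v hv).1, fun h => (hl v hv).2 (Finset.mem_of_mem_erase h)⟩
        · exact fun a ha b hb => he a ha b (Finset.mem_of_mem_erase hb)
        · rw [Finset.card_erase_of_mem hw, List.length_cons]; omega
        · rw [Finset.card_erase_of_mem hw]; omega
      · push Not at hx
        cases l with
        | nil =>
          obtain ⟨w, hw⟩ := Finset.card_pos.1 (by omega : 0 < U.card)
          simpa using hx w hw
        | cons p l =>
          have hpT := (hl p (by simp)).1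
          have hpU := (hl p (by simp)).2
          refine ⟨insert p T, U, l, hc.tail, hn.of_cons, ?_, ?_, ?_, ?_, ?_⟩
          · rw [Finset.disjoint_insert_left]; exact ⟨hpU, hd⟩
          · intro v hv
            have := hl v (by simp [hv])
            have h2 : v ≠ p := by rintro rfl; simp at hn; exact hn.1 hv
            simp [this.1, this.2, h2]
          · intro a ha b hb
            rcases Finset.mem_insert.1 ha with rfl | ha
            · have := hx b hb
              simpa [F.adj_comm] using this
            · exact he a ha b hb
          · rw [Finset.card_insert_of_notMem hpT, hT]
          · rw [Finset.card_insert_of_notMem hpT]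
            simp at hN ⊢; omega

/-! ### Hamiltonian paths in almost complete graphs -/

theorem List.countP_le_of_isChain_not_and {V : Type*} (p : V → Prop) [DecidablePred p] (l : List V)
    (h : l.IsChain (fun x y => ¬ (p x ∧ p y))) :
    l.length ≤ 2 * l.countP (fun x => ¬ p x) + 1 := by
  induction l using List.twoStepInduction with
  | nil => simp
  | singleton x => simp
  | cons_cons x y l ih1 ih2 =>
    rw [List.isChain_cons_cons] at h
    have h1 := ih1 h.2.tail
    have h2 := ih2 y h.2
    simp only [List.countP_cons, List.length_cons] at h1 h2 ⊢
    by_cases hx : p x <;> by_cases hy : p y <;> simp_all <;> omega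

theorem List.exists_append_of_not_isChain {V : Type*} {R : V → V → Prop} {l : List V}
    (h : ¬ l.IsChain R) : ∃ l₁ x y l₂, l = l₁ ++ x :: y :: l₂ ∧ ¬ R x y := by
  induction l with
  | nil => simp at h
  | cons x l ih =>
    cases l with
    | nil => simp at h
    | cons y l =>
      rw [List.isChain_cons_cons] at h
      by_cases hR : R x y
      · obtain ⟨l₁, u, v, l₂, e, h'⟩ := ih (fun h' => h ⟨hR, h'⟩)
        exact ⟨x :: l₁, u, v, l₂, by simp [e], h'⟩
      · exact ⟨[], x, y, l, rfl, hR⟩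

/-- A graph on `X` in which every vertex misses at most `d` others, with `3 * d + 2 ≤ #X`, has a
Hamiltonian path starting at any prescribed vertex. -/
theorem SimpleGraph.exists_hamiltonian_chain {V : Type*} (F : SimpleGraph V) [DecidableEq V] [DecidableRel Fᶜ.Adj]
    (X : Finset V) (d : ℕ) (hX : 3 * d + 2 ≤ X.card)
    (hd : ∀ x ∈ X, (X.filter (Fᶜ.Adj x)).card ≤ d) (a : V) (ha : a ∈ X) :
    ∃ l : List V, (a :: l).IsChain F.Adj ∧ (a :: l).Nodup ∧ (a :: l).toFinset = X := by
  classical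
  have key : ∀ j, ∀ l : List V, (a :: l).IsChain F.Adj → (a :: l).Nodup → (a :: l).toFinset ⊆ X →
      X.card - (a :: l).length = j →
      ∃ l : List V, (a :: l).IsChain F.Adj ∧ (a :: l).Nodup ∧ (a :: l).toFinset = X := by
    intro j
    induction j using Nat.strong_induction_on with
    | _ j ih =>
    intro l hc hn hs hj
    by_cases hEq : (a :: l).toFinset = X
    · exact ⟨l, hc, hn, hEq⟩
    have hlt := Finset.card_lt_card (Finset.ssubset_iff_subset_ne.2 ⟨hs, hEq⟩)
    rw [List.toFinset_card_of_nodup hn] at hlt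
    have ext : ∀ l' w, w ∈ X → w ∉ (a :: l) → (a :: l').IsChain F.Adj →
        (a :: l').Perm (w :: a :: l) →
        ∃ l : List V, (a :: l).IsChain F.Adj ∧ (a :: l).Nodup ∧ (a :: l).toFinset = X := by
      intro l' w hw hwl hc' hp
      refine ih (X.card - (a :: l').length) ?_ l' hc' ?_ ?_ rfl
      · rw [hp.length_eq, List.length_cons (a := w)]; omega
      · rw [hp.nodup_iff]; exact List.nodup_cons.2 ⟨hwl, hn⟩
      · rw [List.toFinset_eq_of_perm _ _ hp, List.toFinset_cons]
        exact Finset.insert_subset hw hs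
    by_cases hend : ∃ w ∈ X, w ∉ a :: l ∧ F.Adj ((a :: l).getLast (by simp)) w
    · obtain ⟨w, hw, hwl, hadj⟩ := hend
      refine ext (l ++ [w]) w hw hwl ?_ ?_
      · rw [← List.cons_append, List.isChain_append]
        refine ⟨hc, by simp, ?_⟩
        intro x hx y hy
        rw [List.getLast?_eq_getLast_of_ne_nil (by simp)] at hx
        simp at hx hy
        subst hx hy
        exact hadj
      · rw [← List.cons_append]
        exact List.perm_append_singleton _ _
    -- All vertices off the path are non-neighbours of its end `e`, so at most `d` are missing and
    -- the path has at least `2 * d + 2` vertices.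
    · push Not at hend
      set e := (a :: l).getLast (by simp) with he
      have heX : e ∈ X := hs (by rw [List.mem_toFinset]; exact List.getLast_mem _)
      have h1 : (X \ (a :: l).toFinset).card ≤ d := by
        refine le_trans (Finset.card_le_card ?_) (hd e heX)
        intro w hw
        rw [Finset.mem_sdiff, List.mem_toFinset] at hw
        rw [Finset.mem_filter, SimpleGraph.compl_adj]
        refine ⟨hw.1, ?_, hend w hw.1 hw.2⟩
        rintro rfl
        exact hw.2 (List.getLast_mem _)
      rw [Finset.card_sdiff_of_subset hs, List.toFinset_card_of_nodup hn] at h1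
      obtain ⟨w, hw, hwl⟩ := Finset.exists_of_ssubset (Finset.ssubset_iff_subset_ne.2 ⟨hs, hEq⟩)
      rw [List.mem_toFinset] at hwl
      have h2 : (a :: l).countP (fun x => ¬ F.Adj w x) ≤ d := by
        refine le_trans ?_ (hd w hw)
        rw [List.countP_eq_length_filter, ← List.toFinset_card_of_nodup (hn.filter _)]
        refine Finset.card_le_card ?_
        intro x hx
        rw [List.mem_toFinset, List.mem_filter] at hx
        rw [Finset.mem_filter, SimpleGraph.compl_adj]
        refine ⟨hs (by rw [List.mem_toFinset]; exact hx.1), ?_, by simpa using hx.2⟩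
        rintro rfl
        exact hwl hx.1
      -- A missing `w` has at most `d` non-neighbours on the path, too few to separate its
      -- neighbours there. So `w` fits between two consecutive vertices, and the start `a` is kept.
      by_cases hch : (a :: l).IsChain (fun x y => ¬ (F.Adj w x ∧ F.Adj w y))
      · have := List.countP_le_of_isChain_not_and (fun x => F.Adj w x) _ hch
        omega
      · obtain ⟨l₁, x, y, l₂, e', hxy⟩ := List.exists_append_of_not_isChain hch
        push Not at hxy
        obtain ⟨l', hl'⟩ : ∃ l', l₁ ++ x :: w :: y :: l₂ = a :: l' := by
          cases l₁ with
          | nil => simp at e'; exact ⟨_, by rw [e'.1]; rfl⟩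
          | cons b l₁ => simp at e'; exact ⟨_, by rw [e'.1]; rfl⟩
        refine ext l' w hw hwl ?_ ?_
        · rw [← hl']
          rw [e', List.isChain_append] at hc
          rw [List.isChain_append]
          refine ⟨hc.1, ?_, by simpa using hc.2.2⟩
          have := hc.2.1
          rw [List.isChain_cons_cons] at this
          rw [List.isChain_cons_cons, List.isChain_cons_cons]
          exact ⟨hxy.1.symm, hxy.2, this.2⟩
        · rw [← hl', e']
          have : (l₁ ++ [x] ++ w :: (y :: l₂)).Perm (w :: (l₁ ++ [x] ++ (y :: l₂))) :=
            List.perm_middle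
          simpa using this
  exact key _ [] (by simp) (by simp) (by simpa using ha) rfl

/-! ### Injective placements with constraints -/

theorem Finset.exists_injOn_mapsTo_of_card_le {ι V : Type*} [Nonempty V]
    {I : Finset ι} {A : Finset V} (h : I.card ≤ A.card) :
    ∃ g : ι → V, Set.InjOn g I ∧ ∀ i ∈ I, g i ∈ A := by
  obtain ⟨g, hg, hi⟩ := Set.Finite.exists_injOn_of_encard_le (s := (I : Set ι)) (t := (A : Set V))
    I.finite_toSet (by simpa using h)
  exact ⟨g, hi, fun i hi => hg hi⟩

/-- Reserve exactly `P.card` elements of `S` for `P` and place the rest of `I` in what remains of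
`A`. In use, `I` consists of cycle positions, `P` of those carrying a spoke, and `S` of neighbours
of the hub. -/
theorem Finset.exists_injOn_mapsTo_of_subset {ι V : Type*} [Nonempty V] [DecidableEq ι]
    [DecidableEq V] {I P : Finset ι} {A S : Finset V} (hP : P ⊆ I) (hS : S ⊆ A)
    (hPS : P.card ≤ S.card) (hIA : I.card ≤ A.card) :
    ∃ g : ι → V, Set.InjOn g I ∧ (∀ i ∈ I, g i ∈ A) ∧ ∀ i ∈ P, g i ∈ S := by
  obtain ⟨S', hS', hc⟩ := Finset.exists_subset_card_eq hPS
  obtain ⟨g₁, h₁, h₁'⟩ := Finset.exists_injOn_mapsTo_of_card_le hc.ge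
  obtain ⟨g₂, h₂, h₂'⟩ := Finset.exists_injOn_mapsTo_of_card_le (I := I \ P) (A := A \ S') (by
      rw [Finset.card_sdiff_of_subset hP, Finset.card_sdiff_of_subset (hS'.trans hS)]; omega)
  refine ⟨fun i => if i ∈ P then g₁ i else g₂ i, ?_, ?_, ?_⟩
  · intro i hi j hj hij
    have hi' := h₁' i
    have hj' := h₁' j
    have hi'' := h₂' i
    have hj'' := h₂' j
    simp only [Finset.mem_sdiff, Finset.mem_coe] at *
    by_cases hiP : i ∈ P <;> by_cases hjP : j ∈ P <;> simp only [hiP, hjP, if_true, if_false] at hij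
    · exact h₁ hiP hjP hij
    · exact absurd (hij ▸ hi' hiP) (hj'' ⟨hj, hjP⟩).2
    · exact absurd (hij ▸ hj' hjP) (hi'' ⟨hi, hiP⟩).2
    · exact h₂ (by simp [hi, hiP]) (by simp [hj, hjP]) hij
  · intro i hi
    by_cases hiP : i ∈ P
    · simpa [hiP] using hS (hS' (h₁' i hiP))
    · simpa [hiP] using (Finset.mem_sdiff.1 (h₂' i (by simp [hi, hiP]))).1
  · intro i hi
    simpa [hi] using hS' (h₁' i hi)

/-- The prescribed value `w` may lie in `S`, which costs one element there; hence the `+ 1`. -/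
theorem Finset.exists_injOn_mapsTo_of_subset_of_eq {ι V : Type*} [DecidableEq ι]
    [DecidableEq V] {I P : Finset ι} {A S : Finset V} (hP : P ⊆ I) (hS : S ⊆ A)
    (hPS : P.card + 1 ≤ S.card) (hIA : I.card ≤ A.card) {i₀ : ι} (hi₀ : i₀ ∈ I) (hi₀P : i₀ ∉ P)
    {w : V} (hw : w ∈ A) :
    ∃ g : ι → V, Set.InjOn g I ∧ (∀ i ∈ I, g i ∈ A) ∧ (∀ i ∈ P, g i ∈ S) ∧ g i₀ = w := by
  have : Nonempty V := ⟨w⟩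
  obtain ⟨g, h₁, h₂, h₃⟩ := Finset.exists_injOn_mapsTo_of_subset (I := I.erase i₀) (P := P)
    (A := A.erase w) (S := S.erase w)
    (fun i hi => Finset.mem_erase.2 ⟨fun h => hi₀P (h ▸ hi), hP hi⟩)
    (Finset.erase_subset_erase _ hS)
    (by have := Finset.pred_card_le_card_erase (s := S) (a := w); omega)
    (by rw [Finset.card_erase_of_mem hi₀, Finset.card_erase_of_mem hw]; omega)
  have h₂' : ∀ i ∈ I, i ≠ i₀ → g i ∈ A ∧ g i ≠ w := fun i hi hne => by
    have := h₂ i (Finset.mem_erase.2 ⟨hne, hi⟩)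
    rw [Finset.mem_erase] at this
    exact this.symm
  refine ⟨Function.update g i₀ w, ?_, ?_, ?_, by simp⟩
  · intro i hi j hj hij
    by_cases hi' : i = i₀ <;> by_cases hj' : j = i₀
    · rw [hi', hj']
    · subst hi'
      simp [Function.update_of_ne hj'] at hij
      exact absurd hij.symm (h₂' j hj hj').2
    · subst hj'
      simp [Function.update_of_ne hi'] at hij
      exact absurd hij (h₂' i hi hi').2
    · rw [Function.update_of_ne hi', Function.update_of_ne hj'] at hij
      exact h₁ (by simpa [hi'] using hi) (by simpa [hj'] using hj) hij
  · intro i hi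
    by_cases hi' : i = i₀
    · simpa [hi'] using hw
    · rw [Function.update_of_ne hi']; exact (h₂' i hi hi').1
  · intro i hi
    rw [Function.update_of_ne (show i ≠ i₀ by rintro rfl; exact hi₀P hi)]
    exact Finset.mem_of_mem_erase (h₃ i hi)

/-! ### Embedding the Jahangir graph across two joined sets -/

theorem SimpleGraph.cycleGraph_adj_iff_val {k : ℕ} (i j : Fin k) (hk : 2 ≤ k) :
    (SimpleGraph.cycleGraph k).Adj i j ↔ i.val + 1 = j.val ∨ j.val + 1 = i.val ∨
      (i.val = 0 ∧ j.val + 1 = k) ∨ (j.val = 0 ∧ i.val + 1 = k) := by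
  have hi := i.isLt
  have hj := j.isLt
  have key : ∀ a b : Fin k, (a - b).val = 1 ↔ b.val + 1 = a.val ∨ (a.val = 0 ∧ b.val + 1 = k) := by
    intro a b
    have ha := a.isLt
    have hb := b.isLt
    rw [Fin.sub_def]
    simp only
    by_cases h : b.val ≤ a.val
    · rw [show k - b.val + a.val = (a.val - b.val) + k by omega, Nat.add_mod_right,
        Nat.mod_eq_of_lt (by omega)]
      omega
    · rw [Nat.mod_eq_of_lt (by omega)]
      omega
  rw [SimpleGraph.cycleGraph_adj', key, key]
  omega

theorem jahangirGraph_isContained_of_map {V : Type*} {G : SimpleGraph V} {s m : ℕ}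
    (hk : 2 ≤ s * m) (x : V) (f : ℕ → V) (hinj : Set.InjOn f (Set.Iio (s * m)))
    (hx : ∀ i < s * m, f i ≠ x) (hsucc : ∀ i, i + 1 < s * m → G.Adj (f i) (f (i + 1)))
    (hlast : G.Adj (f (s * m - 1)) (f 0)) (hhub : ∀ i < s * m, s ∣ i → G.Adj x (f i)) :
    (jahangirGraph s m).IsContained G := by
  refine ⟨⟨⟨fun o => o.elim x (fun i => f i.val), ?_⟩, ?_⟩⟩
  · rintro (_ | i) (_ | j) h
    · exact h.elim
    · exact hhub j.val j.isLt h
    · exact (hhub i.val i.isLt h).symm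
    · have h' : (SimpleGraph.cycleGraph (s * m)).Adj i j := h
      rw [SimpleGraph.cycleGraph_adj_iff_val i j hk] at h'
      have hi := i.isLt
      have hj := j.isLt
      change G.Adj (f i.val) (f j.val)
      rcases h' with h | h | ⟨h0, h1⟩ | ⟨h0, h1⟩
      · rw [← h]; exact hsucc _ (by omega)
      · rw [← h]; exact (hsucc _ (by omega)).symm
      · rw [h0, show j.val = s * m - 1 by omega]; exact hlast.symm
      · rw [h0, show i.val = s * m - 1 by omega]; exact hlast
  · rintro (_ | i) (_ | j) h
    · rfl
    · exact absurd h.symm (hx j.val j.isLt)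
    · exact absurd h (hx i.val i.isLt)
    · exact congrArg some (Fin.ext (hinj i.isLt j.isLt h))

theorem Nat.card_filter_dvd_range_mul_le (s m : ℕ) :
    ((Finset.range (s * m)).filter (s ∣ ·)).card ≤ m := by
  refine le_trans (Finset.card_le_card (t := (Finset.range m).image (s * ·)) ?_)
    (le_trans Finset.card_image_le (by simp))
  intro i hi
  simp only [Finset.mem_filter, Finset.mem_range, Finset.mem_image] at hi ⊢
  obtain ⟨h, j, rfl⟩ := hi
  exact ⟨j, Nat.lt_of_mul_lt_mul_left h, rfl⟩

/-- Among the `m` multiples of `s`, at least `0` and `2 * s` are even. -/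
theorem Nat.card_filter_dvd_odd_range_mul_le (s m : ℕ) (hm : 3 ≤ m) :
    ((Finset.range (s * m)).filter (fun i => s ∣ i ∧ Odd i)).card + 2 ≤ m := by
  have : ((Finset.range (s * m)).filter (fun i => s ∣ i ∧ Odd i)).card ≤
      (((Finset.range m).erase 0).erase 2).card := by
    refine le_trans (Finset.card_le_card
      (t := (((Finset.range m).erase 0).erase 2).image (s * ·)) ?_) Finset.card_image_le
    intro i hi
    simp only [Finset.mem_filter, Finset.mem_range, Finset.mem_image, Finset.mem_erase] at hi ⊢
    obtain ⟨h, ⟨j, rfl⟩, ho⟩ := hi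
    refine ⟨j, ⟨?_, ?_, Nat.lt_of_mul_lt_mul_left h⟩, rfl⟩
    · rintro rfl; simp [Nat.odd_mul] at ho; exact absurd ho.2 (by decide)
    · rintro rfl; simp at ho
  rw [Finset.card_erase_of_mem (by simp; omega), Finset.card_erase_of_mem (by simp; omega)] at this
  simp at this
  omega

/-- Even positions go to `A`, odd ones to `B`. Each side has at most `m` spoke positions, so the
neighbours of `x` there suffice. -/
theorem jahangirGraph_isContained_of_hub {V : Type*} {G : SimpleGraph V} [DecidableRel G.Adj] {s m : ℕ}
    (hk : 2 ≤ s * m) (he : Even (s * m)) {A B : Finset V}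
    (hAB : ∀ a ∈ A, ∀ b ∈ B, G.Adj a b) (hA : s * m ≤ A.card) (hB : s * m ≤ B.card) (x : V)
    (hxA : m ≤ (A.filter (G.Adj x)).card) (hxB : m ≤ (B.filter (G.Adj x)).card) :
    (jahangirGraph s m).IsContained G := by
  classical
  have : Nonempty V := ⟨x⟩
  have inj : ∀ (C : Finset V) (p : ℕ → Prop), s * m ≤ C.card → m ≤ (C.filter (G.Adj x)).card →
      (∃ j < s * m, ¬ p j) →
      ∃ g : ℕ → V, (∀ i < s * m, p i → ∀ j < s * m, p j → g i = g j → i = j) ∧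
        (∀ i < s * m, p i → g i ∈ C ∧ g i ≠ x) ∧ ∀ i < s * m, p i → s ∣ i → G.Adj x (g i) := by
    rintro C p hC hm ⟨j, hj, hpj⟩
    obtain ⟨g, h₁, h₂, h₃⟩ := Finset.exists_injOn_mapsTo_of_subset
      (I := (Finset.range (s * m)).filter p) (P := (Finset.range (s * m)).filter (fun i => p i ∧ s ∣ i))
      (A := C.erase x) (S := C.filter (G.Adj x))
      (by intro i; simp; tauto)
      (by intro v; simp only [Finset.mem_filter, Finset.mem_erase]
          exact fun h => ⟨h.2.ne', h.1⟩)
      (by refine le_trans (Finset.card_le_card ?_)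
            (le_trans (Nat.card_filter_dvd_range_mul_le s m) hm)
          intro i; simp; tauto)
      -- Some position `j` belongs to the other side, which leaves room for discarding `x`.
      (by
        have h1 : ((Finset.range (s * m)).filter p).card ≤ ((Finset.range (s * m)).erase j).card := by
          refine Finset.card_le_card ?_
          intro i
          simp only [Finset.mem_filter, Finset.mem_erase]
          rintro ⟨h, hp⟩
          exact ⟨fun e => hpj (e ▸ hp), h⟩
        rw [Finset.card_erase_of_mem (by simpa using hj), Finset.card_range] at h1
        have := Finset.pred_card_le_card_erase (s := C) (a := x)
        omega)
    refine ⟨g, ?_, ?_, ?_⟩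
    · intro i hi hpi j hj hpj
      exact h₁ (by simp [hi, hpi]) (by simp [hj, hpj])
    · intro i hi hpi
      have := h₂ i (by simp [hi, hpi])
      rw [Finset.mem_erase] at this
      exact this.symm
    · intro i hi hpi hd
      exact (Finset.mem_filter.1 (h₃ i (by simp [hi, hpi, hd]))).2
  obtain ⟨g, g₁, g₂, g₃⟩ := inj A Even hA hxA ⟨1, by omega, by decide⟩
  obtain ⟨h, h₁, h₂, h₃⟩ := inj B (fun i => ¬ Even i) hB hxB ⟨0, by omega, by simp⟩
  have hne : ∀ i < s * m, Even i → ∀ j < s * m, ¬ Even j → g i ≠ h j := fun i hi hi' j hj hj' =>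
    (hAB _ (g₂ i hi hi').1 _ (h₂ j hj hj').1).ne
  refine jahangirGraph_isContained_of_map hk x (fun i => if Even i then g i else h i)
    ?_ ?_ ?_ ?_ ?_
  · intro i hi j hj hij
    rw [Set.mem_Iio] at hi hj
    by_cases hi' : Even i <;> by_cases hj' : Even j <;>
      simp only [hi', hj', if_true, if_false] at hij
    · exact g₁ i hi hi' j hj hj' hij
    · exact absurd hij (hne i hi hi' j hj hj')
    · exact absurd hij.symm (hne j hj hj' i hi hi')
    · exact h₁ i hi hi' j hj hj' hij
  · intro i hi
    split_ifs with h'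
    · exact (g₂ i hi h').2
    · exact (h₂ i hi h').2
  · intro i hi
    have h'' := Nat.even_add_one (n := i)
    by_cases hi' : Even i
    · have : ¬ Even (i + 1) := by tauto
      simp only [hi', this, if_true, if_false]
      exact hAB _ (g₂ i (by omega) hi').1 _ (h₂ _ hi this).1
    · have : Even (i + 1) := by tauto
      simp only [hi', this, if_true, if_false]
      exact (hAB _ (g₂ _ hi this).1 _ (h₂ i (by omega) hi').1).symm
  · have h1 : ¬ Even (s * m - 1) := by
      rw [Nat.not_even_iff_odd]; exact Nat.Even.sub_odd (by omega) he odd_one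
    simp only [h1, if_false, Even.zero, if_true]
    exact (hAB _ (g₂ 0 (by omega) (by simp)).1 _ (h₂ _ (by omega) h1).1).symm
  · intro i hi hd
    split_ifs with h'
    · exact g₃ i hi h' hd
    · exact h₃ i hi h' hd

/-- An odd cycle cannot alternate, so `y`, with neighbours on both sides, takes position `s * m - 1`
to repair parity. Even positions go to `B`, where spokes from the hub `x` in `A` are automatic; only
odd multiples of `s` need neighbours of `x` in `A`. -/
theorem jahangirGraph_isContained_of_two_exceptional {V : Type*} {G : SimpleGraph V} [DecidableRel G.Adj] {s m : ℕ}
    (hs : 3 ≤ s) (hm : 3 ≤ m) (ho : Odd (s * m)) {A B : Finset V}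
    (hAB : ∀ a ∈ A, ∀ b ∈ B, G.Adj a b) (hA : s * m ≤ A.card) (hB : s * m ≤ B.card) (x y : V)
    (hxA : x ∈ A) (hxy : x ≠ y) (hx : m ≤ (A.filter (G.Adj x)).card)
    (hyA : m ≤ (A.filter (G.Adj y)).card) (hyB : m ≤ (B.filter (G.Adj y)).card) :
    (jahangirGraph s m).IsContained G := by
  classical
  have hk : 9 ≤ s * m := by nlinarith
  have hodd : Odd (s * m - 2) := Nat.Odd.sub_even (by omega) ho (by decide)
  have hlast : ¬ s ∣ s * m - 1 := by
    intro h
    have h' := Nat.dvd_sub (Nat.dvd_mul_right s m) h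
    rw [show s * m - (s * m - 1) = 1 by omega] at h'
    exact absurd (Nat.le_of_dvd one_pos h') (by omega)
  have hlast₂ : ¬ s ∣ s * m - 2 := by
    intro h
    have h' := Nat.dvd_sub (Nat.dvd_mul_right s m) h
    rw [show s * m - (s * m - 2) = 2 by omega] at h'
    exact absurd (Nat.le_of_dvd two_pos h') (by omega)
  obtain ⟨u, hu⟩ : (B.filter (G.Adj y)).Nonempty := Finset.card_pos.1 (by omega)
  obtain ⟨w, hw⟩ : ((A.filter (G.Adj y)).erase x).Nonempty := Finset.card_pos.1 (by
    have := Finset.pred_card_le_card_erase (s := A.filter (G.Adj y)) (a := x)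
    omega)
  rw [Finset.mem_filter] at hu
  rw [Finset.mem_erase, Finset.mem_filter] at hw
  -- The cycle neighbours of `y` sit at `s * m - 2`, sent to `w` in `A`, and at `0`, sent to `u` in
  -- `B`. As `s ≥ 3`, position `s * m - 2` carries no spoke. At most `m - 2` odd spokes meet at
  -- least `m - 1` neighbours of `x` other than `y`.
  obtain ⟨g, g₁, g₂, g₃, g₄⟩ := Finset.exists_injOn_mapsTo_of_subset_of_eq
    (I := (Finset.range (s * m - 1)).filter Odd)
    (P := ((Finset.range (s * m)).filter (fun i => s ∣ i ∧ Odd i)))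
    (A := (A.erase x).erase y) (S := (A.filter (G.Adj x)).erase y) (i₀ := s * m - 2) (w := w)
    (by intro i
        simp only [Finset.mem_filter, Finset.mem_range]
        rintro ⟨h, hd, ho⟩
        have : i ≠ s * m - 1 := by rintro rfl; exact hlast hd
        exact ⟨by omega, ho⟩)
    (by refine Finset.erase_subset_erase _ ?_
        intro v
        simp only [Finset.mem_filter, Finset.mem_erase]
        exact fun h => ⟨h.2.ne', h.1⟩)
    (by have := Finset.pred_card_le_card_erase (s := A.filter (G.Adj x)) (a := y)
        have := Nat.card_filter_dvd_odd_range_mul_le s m hm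
        omega)
    (by have h1 : ((Finset.range (s * m - 1)).filter Odd).card ≤
            ((Finset.range (s * m - 1)).erase 0).card := by
          refine Finset.card_le_card ?_
          intro i
          simp only [Finset.mem_filter, Finset.mem_erase]
          rintro ⟨h, hp⟩
          exact ⟨by rintro rfl; simp at hp, h⟩
        rw [Finset.card_erase_of_mem (by simp; omega), Finset.card_range] at h1
        have := Finset.pred_card_le_card_erase (s := A) (a := x)
        have := Finset.pred_card_le_card_erase (s := A.erase x) (a := y)
        omega)
    (by simp only [Finset.mem_filter, Finset.mem_range]; exact ⟨by omega, hodd⟩)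
    (by simp only [Finset.mem_filter, Finset.mem_range]; tauto)
    (by simp only [Finset.mem_erase]; exact ⟨hw.2.2.ne', hw.1, hw.2.1⟩)
  obtain ⟨h, h₁, h₂, -, h₄⟩ := Finset.exists_injOn_mapsTo_of_subset_of_eq
    (I := (Finset.range (s * m - 1)).filter Even) (P := ∅) (A := B.erase y) (S := B.erase y)
    (i₀ := 0) (w := u) (by simp) subset_rfl
    (by have := Finset.pred_card_le_card_erase (s := B) (a := y)
        rw [Finset.card_empty]; omega)
    (by have h1 := Finset.card_filter_le (Finset.range (s * m - 1)) Even
        rw [Finset.card_range] at h1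
        have := Finset.pred_card_le_card_erase (s := B) (a := y)
        omega)
    (by simp; omega) (by simp)
    (by simp only [Finset.mem_erase]; exact ⟨hu.2.ne', hu.1⟩)
  have g₂' : ∀ i < s * m - 1, Odd i → g i ≠ y ∧ g i ≠ x ∧ g i ∈ A := fun i hi hi' => by
    simpa using g₂ i (by simp [hi, hi'])
  have h₂' : ∀ i < s * m - 1, ¬ Odd i → h i ≠ y ∧ h i ∈ B := fun i hi hi' => by
    simpa using h₂ i (by simp [hi, Nat.not_odd_iff_even.1 hi'])
  have hne : ∀ i < s * m - 1, Odd i → ∀ j < s * m - 1, ¬ Odd j → g i ≠ h j :=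
    fun i hi hi' j hj hj' => (hAB _ (g₂' i hi hi').2.2 _ (h₂' j hj hj').2).ne
  set f : ℕ → V := fun i => if i = s * m - 1 then y else if Odd i then g i else h i with hf
  have f₁ : f (s * m - 1) = y := by simp [hf]
  have f₂ : ∀ i < s * m - 1, Odd i → f i = g i := fun i hi hi' => by simp [hf, hi.ne, hi']
  have f₃ : ∀ i < s * m - 1, ¬ Odd i → f i = h i := fun i hi hi' => by
    simp only [hf, hi.ne, hi', if_false]
  have f₄ : ∀ i < s * m - 1, f i ≠ y := fun i hi => by
    by_cases hi' : Odd i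
    · rw [f₂ i hi hi']; exact (g₂' i hi hi').1
    · rw [f₃ i hi hi']; exact (h₂' i hi hi').1
  have f₀ : f 0 = u := by rw [f₃ 0 (by omega) (by simp), h₄]
  refine jahangirGraph_isContained_of_map (by omega) x f ?_ ?_ ?_ ?_ ?_
  · intro i hi j hj hij
    rw [Set.mem_Iio] at hi hj
    by_cases hik : i = s * m - 1 <;> by_cases hjk : j = s * m - 1
    · omega
    · rw [hik, f₁] at hij
      exact absurd hij.symm (f₄ j (by omega))
    · rw [hjk, f₁] at hij
      exact absurd hij (f₄ i (by omega))
    · replace hi : i < s * m - 1 := by omega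
      replace hj : j < s * m - 1 := by omega
      by_cases hi' : Odd i <;> by_cases hj' : Odd j
      · rw [f₂ i hi hi', f₂ j hj hj'] at hij
        exact g₁ (by simp [hi, hi']) (by simp [hj, hj']) hij
      · rw [f₂ i hi hi', f₃ j hj hj'] at hij
        exact absurd hij (hne i hi hi' j hj hj')
      · rw [f₃ i hi hi', f₂ j hj hj'] at hij
        exact absurd hij.symm (hne j hj hj' i hi hi')
      · rw [f₃ i hi hi', f₃ j hj hj'] at hij
        rw [Nat.not_odd_iff_even] at hi' hj'
        exact h₁ (by simp [hi, hi']) (by simp [hj, hj']) hij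
  · intro i hi
    by_cases hik : i = s * m - 1
    · rw [hik, f₁]; exact hxy.symm
    · replace hi : i < s * m - 1 := by omega
      by_cases hi' : Odd i
      · rw [f₂ i hi hi']; exact (g₂' i hi hi').2.1
      · rw [f₃ i hi hi']; exact (hAB x hxA _ (h₂' i hi hi').2).ne'
  · intro i hi
    have h'' := Nat.odd_add_one (n := i)
    by_cases hik : i + 1 = s * m - 1
    · rw [hik, f₁, show i = s * m - 2 by omega, f₂ _ (by omega) hodd, g₄]
      exact hw.2.2.symm
    · by_cases hi' : Odd i
      · rw [f₂ i (by omega) hi', f₃ (i + 1) (by omega) (by tauto)]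
        exact hAB _ (g₂' i (by omega) hi').2.2 _ (h₂' _ (by omega) (by tauto)).2
      · rw [f₃ i (by omega) hi', f₂ (i + 1) (by omega) (by tauto)]
        exact (hAB _ (g₂' _ (by omega) (by tauto)).2.2 _ (h₂' i (by omega) hi').2).symm
  · rw [f₁, f₀]; exact hu.2
  · intro i hi hd
    have : i ≠ s * m - 1 := by rintro rfl; exact hlast hd
    by_cases hi' : Odd i
    · rw [f₂ i (by omega) hi']
      have := g₃ i (by simp [hi, hd, hi'])
      rw [Finset.mem_erase, Finset.mem_filter] at this
      exact this.2.2
    · rw [f₃ i (by omega) hi']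
      exact hAB x hxA _ (h₂' i (by omega) hi').2

/-! ### Maximal separated pairs and the paths they yield -/

/-- Two disjoint vertex sets without an edge between them that cannot be enlarged: every other
vertex has a neighbour in both of them. -/
structure SimpleGraph.IsMaximalSeparated {V : Type*} (F : SimpleGraph V) (A B : Finset V) :
    Prop where
  disjoint : Disjoint A B
  not_adj : ∀ a ∈ A, ∀ b ∈ B, ¬ F.Adj a b
  exists_adj_left : ∀ c, c ∉ A → c ∉ B → ∃ a ∈ A, F.Adj c a
  exists_adj_right : ∀ c, c ∉ A → c ∉ B → ∃ b ∈ B, F.Adj c b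

namespace SimpleGraph.IsMaximalSeparated

variable {V : Type*} {F : SimpleGraph V} {A B : Finset V}

theorem symm (h : F.IsMaximalSeparated A B) : F.IsMaximalSeparated B A :=
  ⟨h.disjoint.symm, fun b hb a ha hab => h.not_adj a ha b hb hab.symm,
    fun c hB hA => h.exists_adj_right c hA hB, fun c hB hA => h.exists_adj_left c hA hB⟩

theorem compl_adj (h : F.IsMaximalSeparated A B) : ∀ a ∈ A, ∀ b ∈ B, Fᶜ.Adj a b :=
  fun a ha b hb => (SimpleGraph.compl_adj _ _ _).2
    ⟨fun e => Finset.disjoint_left.1 h.disjoint ha (e ▸ hb), h.not_adj a ha b hb⟩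

end SimpleGraph.IsMaximalSeparated

-- Stop the search after `q` completions: the stack has fewer than `n` vertices, so completed and
-- unvisited ones number at least `N ≥ 2 * q`. Then maximise the total size; a vertex without
-- neighbours in one set could be added to the other.
open Classical in
theorem SimpleGraph.exists_isMaximalSeparated {V : Type*} [Fintype V] (F : SimpleGraph V)
    {n q N : ℕ} (hN : N + n ≤ Fintype.card V + 1) (hn : 1 ≤ n) (hq : 2 * q ≤ N)
    (hF : ¬ (SimpleGraph.pathGraph n).IsContained F) :
    ∃ A B, F.IsMaximalSeparated A B ∧ q ≤ A.card ∧ q ≤ B.card ∧ N ≤ A.card + B.card := by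
  obtain ⟨T, U, l, hc, hl, hd, -, he, hT, hcard⟩ := F.exists_depthFirstSearch q (by omega)
  have hlen : l.length < n := by
    by_contra h
    exact hF (SimpleGraph.pathGraph_isContained_of_isChain hc hl (by omega))
  let S : Finset (Finset V × Finset V) := Finset.univ.filter (fun p =>
    Disjoint p.1 p.2 ∧ (∀ a ∈ p.1, ∀ b ∈ p.2, ¬ F.Adj a b) ∧ q ≤ p.1.card ∧ q ≤ p.2.card)
  have hTU : (T, U) ∈ S := by
    simp only [S, Finset.mem_filter, Finset.mem_univ, true_and]
    exact ⟨hd, he, by omega, by omega⟩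
  obtain ⟨⟨A, B⟩, hS, hmax⟩ := S.exists_max_image (fun p => p.1.card + p.2.card) ⟨_, hTU⟩
  have h1 := hmax _ hTU
  simp only [S, Finset.mem_filter, Finset.mem_univ, true_and] at hS
  obtain ⟨hdAB, hAB, hA, hB⟩ := hS
  simp only at h1 hdAB hAB hA hB
  refine ⟨A, B, ⟨hdAB, hAB, ?_, ?_⟩, hA, hB, by omega⟩
  · intro c hcA hcB
    by_contra! h
    have := hmax (A, insert c B) (by
      simp only [S, Finset.mem_filter, Finset.mem_univ, true_and]
      refine ⟨Finset.disjoint_insert_right.2 ⟨hcA, hdAB⟩, ?_, hA, ?_⟩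
      · intro a ha b hb
        rcases Finset.mem_insert.1 hb with rfl | hb
        · exact fun h' => h a ha h'.symm
        · exact hAB a ha b hb
      · rw [Finset.card_insert_of_notMem hcB]; omega)
    simp only [Finset.card_insert_of_notMem hcB] at this
    omega
  · intro c hcA hcB
    by_contra! h
    have := hmax (insert c A, B) (by
      simp only [S, Finset.mem_filter, Finset.mem_univ, true_and]
      refine ⟨Finset.disjoint_insert_left.2 ⟨hcB, hdAB⟩, ?_, ?_, hB⟩
      · intro a ha b hb
        rcases Finset.mem_insert.1 ha with rfl | ha
        · exact h b hb
        · exact hAB a ha b hb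
      · rw [Finset.card_insert_of_notMem hcA]; omega)
    simp only [Finset.card_insert_of_notMem hcA] at this
    omega

theorem SimpleGraph.pathGraph_isContained_of_dense {V : Type*} {F : SimpleGraph V} [DecidableRel Fᶜ.Adj]
    {X : Finset V} {m n : ℕ} (hm : 1 ≤ m) (hX : 3 * m ≤ X.card + 1)
    (hd : ∀ x ∈ X, (X.filter (Fᶜ.Adj x)).card < m) (hn : n ≤ X.card) :
    (SimpleGraph.pathGraph n).IsContained F := by
  classical
  obtain ⟨a, ha⟩ := Finset.card_pos.1 (by omega : 0 < X.card)
  obtain ⟨l, hc, hl, hX'⟩ := F.exists_hamiltonian_chain X (m - 1) (by omega)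
    (fun x hx => by have := hd x hx; omega) a ha
  refine SimpleGraph.pathGraph_isContained_of_isChain hc hl ?_
  rw [← List.toFinset_card_of_nodup hl, hX']
  exact hn

/-- Traverse `A` so as to end at `a`, pass through `c`, and traverse `B` starting from `b`. -/
theorem SimpleGraph.pathGraph_isContained_of_dense_of_adj {V : Type*} {F : SimpleGraph V} [DecidableRel Fᶜ.Adj]
    {A B : Finset V} {m n : ℕ} (hm : 1 ≤ m) (hA : 3 * m ≤ A.card + 1) (hB : 3 * m ≤ B.card + 1)
    (hdA : ∀ x ∈ A, (A.filter (Fᶜ.Adj x)).card < m)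
    (hdB : ∀ x ∈ B, (B.filter (Fᶜ.Adj x)).card < m) (hAB : Disjoint A B) {c : V}
    (hcA : c ∉ A) (hcB : c ∉ B) (ha : ∃ a ∈ A, F.Adj c a) (hb : ∃ b ∈ B, F.Adj c b)
    (hn : n ≤ A.card + B.card + 1) : (SimpleGraph.pathGraph n).IsContained F := by
  classical
  obtain ⟨a, ha, hca⟩ := ha
  obtain ⟨b, hb, hcb⟩ := hb
  obtain ⟨l, hc, hl, hl'⟩ := F.exists_hamiltonian_chain A (m - 1) (by omega)
    (fun x hx => by have := hdA x hx; omega) a ha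
  obtain ⟨r, hc', hr, hr'⟩ := F.exists_hamiltonian_chain B (m - 1) (by omega)
    (fun x hx => by have := hdB x hx; omega) b hb
  have hlA : ∀ v, v ∈ a :: l ↔ v ∈ A := fun v => by rw [← hl', List.mem_toFinset]
  have hrB : ∀ v, v ∈ b :: r ↔ v ∈ B := fun v => by rw [← hr', List.mem_toFinset]
  refine SimpleGraph.pathGraph_isContained_of_isChain (l := (a :: l).reverse ++ c :: b :: r)
    ?_ ?_ ?_
  · rw [List.isChain_append]
    refine ⟨?_, List.isChain_cons_cons.2 ⟨hcb, hc'⟩, ?_⟩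
    · rw [List.isChain_reverse]
      exact hc.imp fun _ _ h => h.symm
    · simpa using hca.symm
  · rw [List.nodup_append]
    refine ⟨List.nodup_reverse.2 hl, List.nodup_cons.2 ⟨by rwa [hrB], hr⟩, ?_⟩
    intro v hv w hw
    rw [List.mem_reverse, hlA] at hv
    rcases List.mem_cons.1 hw with rfl | hw
    · rintro rfl; exact hcA hv
    · rw [hrB] at hw
      rintro rfl
      exact Finset.disjoint_left.1 hAB hv hw
  · rw [List.length_append, List.length_reverse, List.length_cons (a := c),
      ← List.toFinset_card_of_nodup hl, ← List.toFinset_card_of_nodup hr, hl', hr']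
    omega

/-- An outside vertex links Hamiltonian paths of the two sides. Without one, the sides partition at
least `2 * n - 1` vertices, so one of them has `n`. -/
theorem SimpleGraph.IsMaximalSeparated.pathGraph_isContained {V : Type*} [Fintype V]
    {F : SimpleGraph V} [DecidableRel Fᶜ.Adj] {A B : Finset V} (h : F.IsMaximalSeparated A B) {m n : ℕ} (hm : 1 ≤ m)
    (hA : 3 * m ≤ A.card + 1) (hB : 3 * m ≤ B.card + 1)
    (hdA : ∀ x ∈ A, (A.filter (Fᶜ.Adj x)).card < m)
    (hdB : ∀ x ∈ B, (B.filter (Fᶜ.Adj x)).card < m) (hn : n ≤ A.card + B.card + 1)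
    (hV : 2 * n ≤ Fintype.card V + 1) : (SimpleGraph.pathGraph n).IsContained F := by
  classical
  by_cases hc : ∃ c, c ∉ A ∧ c ∉ B
  · obtain ⟨c, hcA, hcB⟩ := hc
    exact SimpleGraph.pathGraph_isContained_of_dense_of_adj hm hA hB hdA hdB h.disjoint hcA hcB
      (h.exists_adj_left c hcA hcB) (h.exists_adj_right c hcA hcB) hn
  · push Not at hc
    have hU : A ∪ B = Finset.univ :=
      Finset.eq_univ_iff_forall.2 fun c => Finset.mem_union.2 (or_iff_not_imp_left.2 (hc c))
    have hcard := Finset.card_union_of_disjoint h.disjoint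
    rw [hU, Finset.card_univ] at hcard
    by_cases hnA : n ≤ A.card
    · exact SimpleGraph.pathGraph_isContained_of_dense hm hA hdA hnA
    · exact SimpleGraph.pathGraph_isContained_of_dense hm hB hdB (by omega)

/-! ### Upper bounds -/

theorem ramseyProperty_pathGraph_jahangirGraph_of_even {s m n : ℕ} (hs : 3 ≤ s) (hm : 2 ≤ m)
    (he : Even m) (hn : s * m / 2 * (s * m - 2) ≤ n) :
    RamseyProperty (SimpleGraph.pathGraph n) (jahangirGraph s m) (2 * n - 1) := by
  classical
  intro F
  by_contra hcon
  rw [not_or] at hcon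
  obtain ⟨hP, hJ⟩ := hcon
  have h3 : 3 * m ≤ s * m := Nat.mul_le_mul_right m hs
  have hek : Even (s * m) := he.mul_left s
  -- This linear consequence of the quadratic bound is enough to make both sides have at least `s *
  -- m` vertices.
  have hn' : 2 * (s * m) ≤ n := by
    refine le_trans ?_ hn
    obtain ⟨j, hj⟩ := hek
    rw [hj, show (j + j) / 2 = j by omega]
    have : 4 ≤ j + j - 2 := by omega
    nlinarith
  obtain ⟨A, B, h, hA, hB, hsum⟩ := F.exists_isMaximalSeparated (n := n) (q := s * m) (N := n)
    (by simp; omega) (by omega) hn' hP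
  have dense : ∀ {A B : Finset (Fin (2 * n - 1))}, F.IsMaximalSeparated A B → s * m ≤ A.card →
      s * m ≤ B.card → ∀ x ∈ A, (A.filter (Fᶜ.Adj x)).card < m := by
    intro A B h hA hB x hx
    by_contra! hxm
    refine hJ (jahangirGraph_isContained_of_hub (by omega) hek h.compl_adj hA hB x hxm ?_)
    rw [Finset.filter_true_of_mem (h.compl_adj x hx)]
    omega
  exact hP (h.pathGraph_isContained (m := m) (by omega) (by omega) (by omega) (dense h hA hB)
    (dense h.symm hB hA) (by omega) (by simp; omega))

theorem ramseyProperty_pathGraph_jahangirGraph_of_odd {s m n : ℕ} (hs : Odd s) (hs3 : 3 ≤ s)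
    (hm : 3 ≤ m) (ho : Odd m) (hn : (s * m - 1) / 2 * (s * m - 1) ≤ n) :
    RamseyProperty (SimpleGraph.pathGraph n) (jahangirGraph s m) (2 * n) := by
  classical
  intro F
  by_contra hcon
  rw [not_or] at hcon
  obtain ⟨hP, hJ⟩ := hcon
  have h3 : 3 * m ≤ s * m := Nat.mul_le_mul_right m hs3
  have hok : Odd (s * m) := hs.mul ho
  have hn' : 2 * (s * m + 1) ≤ n := by
    refine le_trans ?_ hn
    obtain ⟨j, hj⟩ := hok
    rw [hj, show (2 * j + 1 - 1) / 2 = j by omega, show 2 * j + 1 - 1 = 2 * j by omega]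
    have : 4 ≤ j := by omega
    nlinarith
  -- The extra `1` in `q` allows for the removal of one exceptional vertex.
  obtain ⟨A, B, h, hA, hB, hsum⟩ := F.exists_isMaximalSeparated (n := n) (q := s * m + 1)
    (N := n + 1) (by simp; omega) (by omega) (by omega) hP
  have key : ∀ {A B : Finset (Fin (2 * n))}, F.IsMaximalSeparated A B → s * m + 1 ≤ A.card →
      s * m + 1 ≤ B.card → n + 1 ≤ A.card + B.card →
      ∀ z ∈ A, (A.filter (Fᶜ.Adj z)).card < m := by
    intro A B h hA hB hsum z hz
    by_contra! hzm
    have hAB := h.compl_adj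
    have hBA := h.symm.compl_adj
    -- With `z` as hub, a second exceptional vertex `y`, in `B` or in `A`, would repair parity.
    have hdB : ∀ y ∈ B, (B.filter (Fᶜ.Adj y)).card < m := by
      intro y hy
      by_contra! hym
      refine hJ (jahangirGraph_isContained_of_two_exceptional hs3 hm hok hAB (by omega) (by omega)
        z y hz (hAB z hz y hy).ne hzm ?_ hym)
      rw [Finset.filter_true_of_mem (hBA y hy)]
      omega
    have hmono : ∀ y, ((A.erase z).filter (Fᶜ.Adj y)).card ≤ (A.filter (Fᶜ.Adj y)).card :=
      fun y => Finset.card_le_card (Finset.filter_subset_filter _ (Finset.erase_subset _ _))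
    have hdA : ∀ y ∈ A.erase z, ((A.erase z).filter (Fᶜ.Adj y)).card < m := by
      intro y hy
      rw [Finset.mem_erase] at hy
      by_contra! hym
      refine hJ (jahangirGraph_isContained_of_two_exceptional hs3 hm hok hAB (by omega) (by omega)
        z y hz hy.1.symm hzm (hym.trans (hmono y)) ?_)
      rw [Finset.filter_true_of_mem (hAB y hy.2)]
      omega
    have hA' : (A.erase z).card + 1 = A.card := Finset.card_erase_add_one hz
    have hdisj : Disjoint (A.erase z) B := h.disjoint.mono_left (Finset.erase_subset _ _)
    -- Otherwise `c` links Hamiltonian paths of `A.erase z` and `B` into one on `A.card + B.card`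
    -- vertices.
    have hC : ∀ c, c ∉ A → c ∉ B → ∀ a ∈ A.erase z, ¬ F.Adj c a := by
      intro c hcA hcB a ha hca
      exact hP (SimpleGraph.pathGraph_isContained_of_dense_of_adj (m := m) (by omega) (by omega)
        (by omega) hdA hdB hdisj (fun hc => hcA (Finset.mem_of_mem_erase hc)) hcB ⟨a, ha, hca⟩
        (h.exists_adj_right c hcA hcB) (by omega))
    have hzA : m ≤ ((A.erase z).filter (Fᶜ.Adj z)).card := by
      rw [Finset.filter_erase, Finset.erase_eq_of_notMem (by simp)]
      exact hzm
    -- All vertices but `z` split into `A.erase z` and its complement, which are not joined.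
    set D : Finset (Fin (2 * n)) := Finset.univ \ A with hD
    have hDmem : ∀ v, v ∈ D ↔ v ∉ A := by simp [hD]
    have hBD : B ⊆ D := fun b hb => (hDmem b).2 fun ha => Finset.disjoint_left.1 h.disjoint ha hb
    have hDcard : D.card + A.card = 2 * n := by
      rw [hD, Finset.card_sdiff_add_card_eq_card (Finset.subset_univ A)]
      simp
    have hDA : ∀ y ∈ D, ∀ a ∈ A.erase z, Fᶜ.Adj y a := by
      intro y hy a ha
      by_cases hyB : y ∈ B
      · exact hBA y hyB a (Finset.mem_of_mem_erase ha)
      · rw [hDmem] at hy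
        refine (SimpleGraph.compl_adj _ _ _).2 ⟨?_, hC y hy hyB a ha⟩
        rintro rfl
        exact hy (Finset.mem_of_mem_erase ha)
    have hBD' := Finset.card_le_card hBD
    -- Here the roles change: `y` would be the hub, and `z` repairs parity between `D` and `A.erase
    -- z`.
    have hdD : ∀ y ∈ D, (D.filter (Fᶜ.Adj y)).card < m := by
      intro y hy
      by_contra! hym
      refine hJ (jahangirGraph_isContained_of_two_exceptional hs3 hm hok hDA (by omega) (by omega)
        y z hy ?_ hym ?_ hzA)
      · rintro rfl
        exact (hDmem y).1 hy hz
      · refine le_trans ?_ (Finset.card_le_card (Finset.filter_subset_filter _ hBD))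
        rw [Finset.filter_true_of_mem (hAB z hz)]
        omega
    -- The two almost complete sets have `2 * n - 1` vertices together.
    by_cases hnA : n ≤ (A.erase z).card
    · exact hP (SimpleGraph.pathGraph_isContained_of_dense (m := m) (by omega) (by omega) hdA hnA)
    · exact hP (SimpleGraph.pathGraph_isContained_of_dense (m := m) (by omega) (by omega) hdD
        (by omega))
  exact hP (h.pathGraph_isContained (m := m) (by omega) (by omega) (by omega)
    (key h hA hB hsum) (key h.symm hB hA (by omega)) (by omega) (by simp))

/-! ### Lower bounds: disjoint cliques and proper colourings -/

open Classical in
/-- A disjoint union of cliques with fewer than `n` vertices each contains no path on `n`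
vertices. -/
theorem SimpleGraph.not_pathGraph_isContained_compl_comap_top {V : Type*} [Fintype V] {n : ℕ}
    (hn : 0 < n) (g : V → ℕ) (hg : ∀ j, (Finset.univ.filter (fun v => g v = j)).card < n) :
    ¬ (SimpleGraph.pathGraph n).IsContained ((⊤ : SimpleGraph ℕ).comap g)ᶜ := by
  rintro ⟨f⟩
  have hstep : ∀ i : ℕ, ∀ hi : i < n, g (f ⟨i, hi⟩) = g (f ⟨0, hn⟩) := by
    intro i
    induction i with
    | zero => exact fun _ => rfl
    | succ i ih =>
      intro hi
      rw [← ih (by omega)]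
      have : (SimpleGraph.pathGraph n).Adj ⟨i + 1, hi⟩ ⟨i, by omega⟩ := by
        rw [SimpleGraph.pathGraph_adj]; simp
      have := f.toHom.map_adj this
      simpa using ((SimpleGraph.compl_adj _ _ _).1 this).2
  have h1 : (Finset.univ.image f).card = n := by
    rw [Finset.card_image_of_injective _ (show Function.Injective f from f.injective)]; simp
  have h2 := hg (g (f ⟨0, hn⟩))
  have h3 : Finset.univ.image f ⊆ Finset.univ.filter (fun v => g v = g (f ⟨0, hn⟩)) := by
    intro v
    simp only [Finset.mem_image, Finset.mem_filter, Finset.mem_univ, true_and]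
    rintro ⟨i, rfl⟩
    exact hstep i.val i.isLt
  have := Finset.card_le_card h3
  omega

theorem Nat.add_mod_two_of_forall_ne_succ {c : ℕ → ℕ} {a b : ℕ} (hab : a ≤ b)
    (hc : ∀ i, a ≤ i → i ≤ b → c i < 2) (hne : ∀ i, a ≤ i → i < b → c i ≠ c (i + 1)) :
    (c a + c b) % 2 = (b - a) % 2 := by
  induction b, hab using Nat.le_induction with
  | base => omega
  | succ b hab ih =>
    have := ih (fun i h h' => hc i h (by omega)) (fun i h h' => hne i h (by omega))
    have h1 := hne b hab (by omega)
    have h2 := hc b hab (by omega)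
    have h3 := hc (b + 1) (by omega) le_rfl
    omega

section Colouring

variable {s m : ℕ} {c : ℕ → ℕ} {x : ℕ}

/-- The values `c i`, `i < s * m`, and `x` at the hub form a proper colouring of `J_{s,m}`. -/
structure IsJahangirColouring (s m : ℕ) (c : ℕ → ℕ) (x : ℕ) : Prop where
  succ : ∀ i, i + 1 < s * m → c i ≠ c (i + 1)
  last : c (s * m - 1) ≠ c 0
  hub : ∀ i < s * m, s ∣ i → x ≠ c i

theorem exists_isJahangirColouring_of_isContained {V : Type*} {g : V → ℕ} (hk : 2 ≤ s * m)
    (h : (jahangirGraph s m).IsContained ((⊤ : SimpleGraph ℕ).comap g)) :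
    ∃ (f : ℕ → V) (u : V), IsJahangirColouring s m (g ∘ f) (g u) ∧
      Set.InjOn f (Set.Iio (s * m)) ∧ ∀ i < s * m, f i ≠ u := by
  obtain ⟨f⟩ := h
  have hadj : ∀ a b, (jahangirGraph s m).Adj a b → g (f a) ≠ g (f b) := fun a b hab => by
    simpa using f.toHom.map_adj hab
  have hcyc : ∀ i j : Fin (s * m), (SimpleGraph.cycleGraph (s * m)).Adj i j →
      g (f (some i)) ≠ g (f (some j)) := fun i j hij => hadj _ _ hij
  have hval : ∀ i (hi : i < s * m),
      (if h : i < s * m then f (some ⟨i, h⟩) else f none) = f (some ⟨i, hi⟩) :=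
    fun i hi => dif_pos hi
  -- Indices off the cycle get a default value, which no condition below sees.
  refine ⟨fun i => if h : i < s * m then f (some ⟨i, h⟩) else f none, f none,
    ⟨?_, ?_, ?_⟩, ?_, ?_⟩
  · intro i hi
    simp only [Function.comp, hval i (by omega), hval _ hi]
    exact hcyc _ _ ((SimpleGraph.cycleGraph_adj_iff_val _ _ hk).2 (Or.inl rfl))
  · simp only [Function.comp, hval (s * m - 1) (by omega), hval 0 (by omega)]
    refine hcyc _ _ ((SimpleGraph.cycleGraph_adj_iff_val _ _ hk).2 (Or.inr (Or.inr (Or.inr ?_))))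
    exact ⟨rfl, by simp only; omega⟩
  · intro i hi hd
    simp only [Function.comp, hval i hi]
    exact hadj none (some ⟨i, hi⟩) hd
  · intro i hi j hj hij
    simp only [hval i hi, hval j hj] at hij
    exact congrArg Fin.val (Option.some.inj (f.injective hij))
  · intro i hi
    simp only [hval i hi]
    exact fun h => by simpa using f.injective h

/-- The hub and the arc between consecutive spokes form a cycle of odd length `s + 2`. The strict
bound on `j` excludes the arc that wraps around to `0`. -/
theorem IsJahangirColouring.exists_two_le (h : IsJahangirColouring s m c x) (hs : Odd s)
    {j : ℕ} (hj : s * j + s < s * m) (hx : x < 2) : ∃ i, s * j ≤ i ∧ i ≤ s * j + s ∧ 2 ≤ c i := by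
  by_contra! hc
  have h1 := Nat.add_mod_two_of_forall_ne_succ (c := c) (a := s * j) (b := s * j + s) (by omega)
    hc (fun i _ h' => h.succ i (by omega))
  have h2 := h.hub (s * j) (by omega) (Nat.dvd_mul_right s j)
  have h3 := h.hub (s * j + s) hj ⟨j + 1, by ring⟩
  have h4 := hc (s * j) (by omega) (by omega)
  have h5 := hc (s * j + s) (by omega) (by omega)
  have h6 := Nat.odd_iff.1 hs
  omega

/-- The cycle from the hub to `2 * s`, on to `s * m - 1`, then `0` and back has odd length `s * (m -
2) + 2` and avoids position `s`. -/
theorem IsJahangirColouring.exists_two_le_of_odd (h : IsJahangirColouring s m c x) (hs : Odd s)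
    (hm : Odd m) (hm3 : 3 ≤ m) (hx : x < 2) : ∃ i, (i = 0 ∨ 2 * s ≤ i) ∧ i < s * m ∧ 2 ≤ c i := by
  by_contra! hc
  have hspos := hs.pos
  have hk : s * 3 ≤ s * m := Nat.mul_le_mul_left s hm3
  have h1 := Nat.add_mod_two_of_forall_ne_succ (c := c) (a := 2 * s) (b := s * m - 1) (by omega)
    (fun i h h' => hc i (Or.inr h) (by omega)) (fun i _ h' => h.succ i (by omega))
  have h2 := h.hub (2 * s) (by omega) (Dvd.intro_left 2 rfl)
  have h3 := h.hub 0 (by omega) (by simp)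
  have h4 := h.last
  have h5 := hc (2 * s) (by omega) (by omega)
  have h6 := hc 0 (by omega) (by omega)
  have h7 := hc (s * m - 1) (by omega) (by omega)
  have h8 := Nat.odd_iff.1 (hs.mul hm)
  omega

theorem IsJahangirColouring.exists_two_le_cycle (h : IsJahangirColouring s m c x)
    (hk : Odd (s * m)) : ∃ i < s * m, 2 ≤ c i := by
  by_contra! hc
  have hpos := hk.pos
  have h1 := Nat.add_mod_two_of_forall_ne_succ (c := c) (a := 0) (b := s * m - 1) (by omega)
    (fun i _ h' => hc i (by omega)) (fun i _ h' => h.succ i (by omega))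
  have h4 := h.last
  have h6 := hc 0 (by omega)
  have h7 := hc (s * m - 1) (by omega)
  have h8 := Nat.odd_iff.1 hk
  omega

end Colouring

theorem SimpleGraph.not_pathGraph_isContained_coloured_cliques {n : ℕ} (N : ℕ) (hn : 2 ≤ n) :
    ¬ (SimpleGraph.pathGraph n).IsContained
      ((⊤ : SimpleGraph ℕ).comap (fun v : Fin N => v.val / (n - 1)))ᶜ := by
  classical
  refine SimpleGraph.not_pathGraph_isContained_compl_comap_top (by omega) _ fun j => ?_
  have : (Finset.univ.filter (fun v : Fin N => v.val / (n - 1) = j)).card ≤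
      (Finset.Ico (j * (n - 1)) (j * (n - 1) + (n - 1))).card := by
    refine Finset.card_le_card_of_injOn Fin.val ?_ Fin.val_injective.injOn
    intro v hv
    simp only [Finset.coe_filter, Finset.mem_univ, true_and, Set.mem_ofPred_eq] at hv
    rw [Nat.div_eq_iff (by omega)] at hv
    simp only [Finset.coe_Ico, Set.mem_Ico]
    omega
  rw [Nat.card_Ico] at this
  omega

theorem not_ramseyProperty_of_lt_two_mul_sub_one {s m n N : ℕ} (hs : Odd s) (hm : 2 ≤ m)
    (hn : 2 ≤ n) (hN : N < 2 * n - 1) :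
    ¬ RamseyProperty (SimpleGraph.pathGraph n) (jahangirGraph s m) N := by
  intro h
  have hspos := hs.pos
  have hk : s * 2 ≤ s * m := Nat.mul_le_mul_left s hm
  have hlt : ∀ v : Fin N, v.val / (n - 1) < 2 := fun v => by
    rw [Nat.div_lt_iff_lt_mul (by omega)]
    omega
  rcases h ((⊤ : SimpleGraph ℕ).comap (fun v : Fin N => v.val / (n - 1)))ᶜ with h | h
  · exact SimpleGraph.not_pathGraph_isContained_coloured_cliques N hn h
  · rw [compl_compl] at h
    obtain ⟨f, u, hc, -, -⟩ := exists_isJahangirColouring_of_isContained (by omega) h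
    obtain ⟨i, -, -, hi⟩ := hc.exists_two_le hs (j := 0) (by omega) (hlt u)
    exact absurd (hlt (f i)) (not_lt.2 hi)

/-- Only the vertex `2 * n - 2` can have a colour other than `0` and `1`. It is not the hub, since
the rim is an odd cycle. The first two arcs force it to position `s`, which the third odd cycle
avoids. -/
theorem not_ramseyProperty_of_lt_two_mul {s m n N : ℕ} (hs : Odd s) (hm : Odd m) (hm3 : 3 ≤ m)
    (hn : 2 ≤ n) (hN : N < 2 * n) :
    ¬ RamseyProperty (SimpleGraph.pathGraph n) (jahangirGraph s m) N := by
  intro h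
  have hspos := hs.pos
  have hk : s * 3 ≤ s * m := Nat.mul_le_mul_left s hm3
  have hlt : ∀ v : Fin N, 2 ≤ v.val / (n - 1) → v.val = 2 * n - 2 := fun v hv => by
    rw [Nat.le_div_iff_mul_le (by omega)] at hv
    have := v.isLt
    omega
  rcases h ((⊤ : SimpleGraph ℕ).comap (fun v : Fin N => v.val / (n - 1)))ᶜ with h | h
  · exact SimpleGraph.not_pathGraph_isContained_coloured_cliques N hn h
  · rw [compl_compl] at h
    obtain ⟨f, u, hc, hinj, hu⟩ := exists_isJahangirColouring_of_isContained (by omega) h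
    have huniq : ∀ i < s * m, ∀ j < s * m, 2 ≤ (f i).val / (n - 1) → 2 ≤ (f j).val / (n - 1) →
        i = j := fun i hi j hj hi' hj' =>
      hinj hi hj (Fin.ext ((hlt _ hi').trans (hlt _ hj').symm))
    obtain ⟨i, hi, hi'⟩ := hc.exists_two_le_cycle (hs.mul hm)
    have hx : u.val / (n - 1) < 2 := by
      by_contra! hx
      exact hu i hi (Fin.ext ((hlt _ hi').trans (hlt _ hx).symm))
    obtain ⟨i₁, ha₁, hb₁, hc₁⟩ := hc.exists_two_le hs (j := 0) (by omega) hx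
    obtain ⟨i₂, ha₂, hb₂, hc₂⟩ := hc.exists_two_le hs (j := 1) (by omega) hx
    obtain ⟨i₃, ha₃, hb₃, hc₃⟩ := hc.exists_two_le_of_odd hs hm hm3 hx
    have h₁₂ := huniq i₁ (by omega) i₂ (by omega) hc₁ hc₂
    have h₁₃ := huniq i₁ (by omega) i₃ hb₃ hc₁ hc₃
    omega

theorem theorem2 (s m n : ℕ) (hs : Odd s) (hs3 : 3 ≤ s) :
    (Even m → 2 ≤ m → s * m / 2 * (s * m - 2) ≤ n →
      IsRamseyNumber (SimpleGraph.pathGraph n) (jahangirGraph s m) (2 * n - 1)) ∧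
    (Odd m → 3 ≤ m → (s * m - 1) / 2 * (s * m - 1) ≤ n →
      IsRamseyNumber (SimpleGraph.pathGraph n) (jahangirGraph s m) (2 * n)) := by
  refine ⟨fun he hm hn => ⟨ramseyProperty_pathGraph_jahangirGraph_of_even hs3 hm he hn, ?_⟩,
    fun ho hm hn => ⟨ramseyProperty_pathGraph_jahangirGraph_of_odd hs hs3 hm ho hn, ?_⟩⟩
  · intro N hN
    by_contra! hlt
    have hk : 3 * 2 ≤ s * m := Nat.mul_le_mul hs3 hm
    have hn2 : 2 ≤ n := le_trans (by
      have h1 : 3 ≤ s * m / 2 := by omega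
      have h2 : 4 ≤ s * m - 2 := by omega
      nlinarith) hn
    exact not_ramseyProperty_of_lt_two_mul_sub_one hs hm hn2 hlt hN
  · intro N hN
    by_contra! hlt
    have hk : 3 * 3 ≤ s * m := Nat.mul_le_mul hs3 hm
    have hn2 : 2 ≤ n := le_trans (by
      have h1 : 4 ≤ (s * m - 1) / 2 := by omega
      have h2 : 8 ≤ s * m - 1 := by omega
      nlinarith) hn
    exact not_ramseyProperty_of_lt_two_mul hs ho hm hn2 hlt hN
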